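/- Let $\mathrm{FI}$ be the category whose objects are the finite sets $[n]=\{1,\dots,n\}$, $n\ge 0$, and whose morphisms are the injections $[m]\hookrightarrow[n]$. An FI-graph $G_\bullet$ is a functor from $\mathrm{FI}$ to the category of finite simple graphs and graph homomorphisms (maps of vertex sets that send edges to edges); write $G_n$ for its value at $[n]$ and $G_f$ for the homomorphism induced by an injection $f$. It is finitely generated if for all $n\gg 0$ and every vertex $v\in V(G_{n+1})$ there are a vertex $v'\in V(G_n)$ and an injection $f:[n]\hookrightarrow[n+1]$ with $G_f(v')=v$. For a finite simple graph $G$, let $\alpha(G)$ denote its independence number, the size of a largest set of pairwise non-adjacent vertices. **Theorem.** Let $G_\bullet$ be a finitely generated FI-graph, and suppose that there are integers $A_0,B_0$ such that $|V(G_n)|=A_0n+B_0$ for all $n\gg 0$. Then there are integers $A,B$ such that $$\alpha(G_n)=An+B\qquad\text{for all } n\gg 0.$$ -/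

import Mathlib

open CategoryTheory Filter

universe u

/-- The objects of the category `FI`: one object `[n] = {1, …, n}` for each natural number `n`.
The finite set `[n]` is modelled by `Fin n`. -/
structure FI : Type where
  of ::
  /-- the number of elements of the object -/
  n : ℕ

/-- Morphisms `[m] ⟶ [n]` of `FI` are the injections from `[m]` to `[n]`. -/
instance FI.category : Category FI where
  Hom a b := Fin a.n ↪ Fin b.n
  id a := Function.Embedding.refl (Fin a.n)
  comp f g := Function.Embedding.trans f g

/-- An injection `[m] ↪ [n]`, seen as a morphism of `FI`. -/
def FI.hom {m n : ℕ} (f : Fin m ↪ Fin n) : FI.of m ⟶ FI.of n := f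

/-- A finite simple graph. -/
structure FinGraph : Type (u + 1) where
  /-- the vertex set -/
  V : Type u
  finite : Finite V
  /-- the adjacency relation -/
  graph : SimpleGraph V

/-- The category of finite simple graphs. Morphisms are graph homomorphisms: maps of vertex sets
that send edges to edges (they need not be injective). -/
instance FinGraph.category : Category FinGraph.{u} where
  Hom G H := G.graph →g H.graph
  id G := SimpleGraph.Hom.id
  comp f g := SimpleGraph.Hom.comp g f

/-- The underlying map on vertices of a morphism of finite graphs. -/
def FinGraph.onVertices {G H : FinGraph.{u}} (φ : G ⟶ H) : G.V → H.V :=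
  (show G.graph →g H.graph from φ)

/-- An `FI`-graph is a functor from `FI` to finite simple graphs and graph homomorphisms. -/
abbrev FIGraph : Type (u + 1) := FI ⥤ FinGraph.{u}

namespace FIGraph

/-- The vertex set of `G_n`. -/
abbrev V (G : FIGraph.{u}) (n : ℕ) : Type u := (G.obj (FI.of n)).V

/-- The graph `G_n`. -/
abbrev graph (G : FIGraph.{u}) (n : ℕ) : SimpleGraph (G.V n) := (G.obj (FI.of n)).graph

/-- The map `G_f` on vertices induced by an injection `f : [m] ↪ [n]`. -/
def vertexMap (G : FIGraph.{u}) {m n : ℕ} (f : Fin m ↪ Fin n) : G.V m → G.V n :=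
  FinGraph.onVertices (G.map (FI.hom f))

/-- An `FI`-graph is finitely generated if, for all `n ≫ 0`, each vertex of `G_{n+1}` is of the
form `G_f(v')` for a vertex `v'` of `G_n` and an injection `f : [n] ↪ [n+1]`. -/
def FinitelyGenerated (G : FIGraph.{u}) : Prop :=
  ∀ᶠ n : ℕ in atTop, ∀ v : G.V (n + 1),
    ∃ (v' : G.V n) (f : Fin n ↪ Fin (n + 1)), G.vertexMap f v' = v

/-- An `FI`-graph is vertex-linear if `|V(G_n)| = A n + B` for some integers `A`, `B` and all
`n ≫ 0`. -/
def VertexLinear (G : FIGraph.{u}) : Prop :=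
  ∃ A B : ℤ, ∀ᶠ n : ℕ in atTop, (Nat.card (G.V n) : ℤ) = A * (n : ℤ) + B

end FIGraph

/-! A vertex of `G_n` whose smallest support has `s` elements has at least `n.choose s` translates,
so linear growth forces `s ≤ 1` (`exists_support_card_le_one`). As any two vertices come from a
fixed level through a common injection, equality and adjacency are eventually reflected by every
`G_f` (`PairGenerated.exists_reflects`). So for large `n` the graph `G_n` lives on `P ⊕ Q × Fin n`
with `P`, `Q` finite, and injections of indices induce graph embeddings. Once there are more indices
than subsets of `Q`, a maximum independent set has equal slices at two indices. Deleting or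
duplicating one of them shows that the independence number is convex in `n`. Its increments are at
most `|Q|`, so it is eventually linear. -/

/-- A map that is injective on `s` extends from `s` to an embedding. -/
theorem Fin.exists_embedding_eqOn {n k : ℕ} (hnk : n ≤ k) (s : Finset (Fin n))
    (φ : Fin n → Fin k) (hφ : Set.InjOn φ s) :
    ∃ F : Fin n ↪ Fin k, ∀ x ∈ s, F x = φ x := by
  obtain ⟨t, hst, ht⟩ := Finset.exists_superset_card_eq (s := s.image φ) (n := n)
    (Finset.card_image_le.trans (by simpa using s.card_le_univ)) (by simpa using hnk)
  obtain ⟨g, hg⟩ := Finset.exists_equiv_extend_of_card_eq (by simpa using ht.symm) hst hφ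
  exact ⟨g.toEmbedding.trans (Function.Embedding.subtype _), fun x hx => hg x hx⟩

/-- Every embedding `g` of `Fin k` factors through any embedding `f` of `Fin k`. -/
theorem Fin.exists_embedding_comp_eq {k m n : ℕ} (hmn : m ≤ n) (f : Fin k ↪ Fin m)
    (g : Fin k ↪ Fin n) : ∃ σ : Fin m ↪ Fin n, f.trans σ = g := by
  have key : ∀ t, Function.extend f g (Fin.castLE hmn) (f t) = g t :=
    fun t => f.injective.extend_apply _ _ _
  obtain ⟨σ, hσ⟩ := Fin.exists_embedding_eqOn hmn (Finset.univ.map f)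
    (Function.extend f g (Fin.castLE hmn)) (by
      rintro x hx y hy hxy
      simp only [Finset.coe_map, Finset.coe_univ, Set.image_univ, Set.mem_range] at hx hy
      obtain ⟨a, rfl⟩ := hx
      obtain ⟨b, rfl⟩ := hy
      rw [key, key] at hxy
      rw [g.injective hxy])
  exact ⟨σ, Function.Embedding.ext fun t => (hσ _ (by simp)).trans (key t)⟩

/-- A finset of size at most `k` is contained in the range of an embedding of `Fin k`. -/
theorem Fin.exists_embedding_subset_range {k m : ℕ} (hkm : k ≤ m) (W : Finset (Fin m))
    (hW : W.card ≤ k) : ∃ g : Fin k ↪ Fin m, ∀ w ∈ W, ∃ x, g x = w := by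
  obtain ⟨t, hWt, ht⟩ := Finset.exists_superset_card_eq hW (by simpa using hkm)
  refine ⟨(t.orderEmbOfFin ht).toEmbedding, fun w hw => ?_⟩
  have : w ∈ Set.range (t.orderEmbOfFin ht) := by
    rw [Finset.range_orderEmbOfFin]; exact hWt hw
  exact this

/-! ### Supports of vertices and the bound on their size. -/

namespace FIGraph

variable {G : FIGraph.{u}}

instance (n : ℕ) : Finite (G.V n) := (G.obj (FI.of n)).finite

theorem vertexMap_trans {l m n : ℕ} (f : Fin l ↪ Fin m) (g : Fin m ↪ Fin n) (v : G.V l) :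
    G.vertexMap (f.trans g) v = G.vertexMap g (G.vertexMap f v) := by
  have h : G.map (FI.hom (f.trans g)) = G.map (FI.hom f) ≫ G.map (FI.hom g) :=
    G.map_comp (FI.hom f) (FI.hom g)
  unfold vertexMap
  rw [h]
  rfl

theorem vertexMap_refl {n : ℕ} (v : G.V n) :
    G.vertexMap (Function.Embedding.refl (Fin n)) v = v := by
  have h : G.map (FI.hom (Function.Embedding.refl (Fin n))) = 𝟙 _ := G.map_id (FI.of n)
  unfold vertexMap
  rw [h]
  rfl

theorem adj_vertexMap {m n : ℕ} (f : Fin m ↪ Fin n) {u v : G.V m} (h : (G.graph m).Adj u v) :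
    (G.graph n).Adj (G.vertexMap f u) (G.vertexMap f v) :=
  SimpleGraph.Hom.map_adj
    (show (G.graph m) →g (G.graph n) from G.map (FI.hom f)) h

/-- A vertex `v` of `G_n` is supported on `T` if `G_f(v)` only depends on the restriction of the
injection `f` to `T`. -/
def SupportedOn {n : ℕ} (v : G.V n) (T : Finset (Fin n)) : Prop :=
  ∀ ⦃k : ℕ⦄ (f g : Fin n ↪ Fin k), (∀ t ∈ T, f t = g t) → G.vertexMap f v = G.vertexMap g v

theorem SupportedOn.mono {n : ℕ} {v : G.V n} {S T : Finset (Fin n)} (h : SupportedOn v S)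
    (hST : S ⊆ T) : SupportedOn v T :=
  fun _ f g hfg => h f g fun t ht => hfg t (hST ht)

theorem SupportedOn.vertexMap {m n : ℕ} {v : G.V m} {T : Finset (Fin m)} (h : SupportedOn v T)
    (f : Fin m ↪ Fin n) : SupportedOn (G.vertexMap f v) (T.map f) := by
  intro k g g' hg
  rw [← vertexMap_trans, ← vertexMap_trans]
  exact h _ _ fun t ht => hg (f t) (Finset.mem_map_of_mem f ht)

theorem supportedOn_univ {n : ℕ} (v : G.V n) : SupportedOn v Finset.univ := fun _ f g h => by
  rw [Function.Embedding.ext fun t => h t (Finset.mem_univ t)]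

/-- Go from `f` to `g` in three moves, `f → f₁ → f₂ → g`, agreeing on `S`, `T`, `S` in turn. The
size bound leaves room for `f₁` to send `T \ S` outside `f(S) ∪ g(S)`, so that `f₂` can be `g` on
`S` and `f₁` on `T`. -/
theorem SupportedOn.inter {n : ℕ} {v : G.V n} {S T : Finset (Fin n)} (hS : SupportedOn v S)
    (hT : SupportedOn v T) (hn : 2 * S.card + T.card ≤ n) : SupportedOn v (S ∩ T) := by
  classical
  intro k f g hfg
  have hnk : n ≤ k := by simpa using Fintype.card_le_of_embedding f
  let U : Finset (Fin k) := (S.map f ∪ S.map g)ᶜ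
  have hU : (T \ S).card ≤ U.card := by
    have h1 : (S.map f ∪ S.map g).card ≤ S.card + S.card := by
      simpa using Finset.card_union_le (S.map f) (S.map g)
    have h2 : (T \ S).card ≤ T.card := Finset.card_le_card Finset.sdiff_subset
    rw [Finset.card_compl, Fintype.card_fin]
    omega
  obtain ⟨e⟩ : Nonempty (↥(T \ S) ↪ ↥U) :=
    Function.Embedding.nonempty_of_card_le (by rwa [Fintype.card_coe, Fintype.card_coe])
  have he : ∀ x, (e x : Fin k) ∉ S.map f ∧ (e x : Fin k) ∉ S.map g := by
    intro x
    have := (e x).2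
    simp only [U, Finset.mem_compl, Finset.mem_union, not_or] at this
    exact this
  obtain ⟨f₁, hf₁⟩ := Fin.exists_embedding_eqOn hnk (S ∪ T)
    (fun x => if h : x ∈ T \ S then e ⟨x, h⟩ else f x) (by
      intro x hx y hy hxy
      simp only [Finset.coe_union, Set.mem_union, Finset.mem_coe] at hx hy
      have mS : ∀ z, (z ∈ S ∨ z ∈ T) → z ∉ T \ S → z ∈ S := by
        intro z hz; simp only [Finset.mem_sdiff]; tauto
      by_cases h1 : x ∈ T \ S <;> by_cases h2 : y ∈ T \ S <;>
        simp only [h1, h2, dif_pos, dif_neg, not_false_eq_true] at hxy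
      · simpa using e.injective (Subtype.ext hxy)
      · exact absurd (hxy ▸ Finset.mem_map_of_mem f (mS y hy h2)) (he _).1
      · exact absurd (hxy ▸ Finset.mem_map_of_mem f (mS x hx h1)) (he _).1
      · exact f.injective hxy)
  have hf₁S : ∀ x ∈ S, f₁ x = f x := fun x hx => by
    rw [hf₁ x (by simp [hx]), dif_neg (by simp [hx])]
  have hf₁T : ∀ x ∈ T, x ∉ S → f₁ x ∉ S.map g := fun x hx hxS => by
    rw [hf₁ x (by simp [hx]), dif_pos (by simp [hx, hxS])]
    exact (he _).2
  obtain ⟨f₂, hf₂⟩ := Fin.exists_embedding_eqOn hnk (S ∪ T)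
    (fun x => if x ∈ S then g x else f₁ x) (by
      intro x hx y hy hxy
      simp only [Finset.coe_union, Set.mem_union, Finset.mem_coe] at hx hy
      by_cases h1 : x ∈ S <;> by_cases h2 : y ∈ S <;> simp only [h1, h2, if_true, if_false] at hxy
      · exact g.injective hxy
      · exact absurd (hxy ▸ Finset.mem_map_of_mem g h1) (hf₁T y (by tauto) h2)
      · exact absurd (hxy ▸ Finset.mem_map_of_mem g h2) (hf₁T x (by tauto) h1)
      · exact f₁.injective hxy)
  calc G.vertexMap f v = G.vertexMap f₁ v := hS _ _ fun t ht => (hf₁S t ht).symm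
    _ = G.vertexMap f₂ v := hT _ _ fun t ht => by
        rw [hf₂ t (by simp [ht])]
        by_cases h : t ∈ S
        · rw [if_pos h, hf₁S t h, hfg t (by simp [h, ht])]
        · rw [if_neg h]
    _ = G.vertexMap g v := hS _ _ fun t ht => by rw [hf₂ t (by simp [ht]), if_pos ht]

/-- If `w` is supported on `T` and `g` covers `h(T)`, then `G_h(w)` is in the image of `G_g`. -/
theorem SupportedOn.exists_vertexMap_eq {k l m : ℕ} {w : G.V k} {T : Finset (Fin k)}
    (hw : SupportedOn w T) (hkl : k ≤ l) (h : Fin k ↪ Fin m) (g : Fin l ↪ Fin m)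
    (hg : ∀ t ∈ T, ∃ x, g x = h t) : ∃ w' : G.V l, G.vertexMap g w' = G.vertexMap h w := by
  classical
  obtain ⟨τ, hτ⟩ := Fin.exists_embedding_eqOn hkl T
    (fun t => if ht : t ∈ T then (hg t ht).choose else Fin.castLE hkl t) (by
      intro x hx y hy hxy
      simp only [Finset.mem_coe] at hx hy
      simp only [hx, hy, dif_pos] at hxy
      apply h.injective
      rw [← (hg x hx).choose_spec, ← (hg y hy).choose_spec, hxy])
  refine ⟨G.vertexMap τ w, ?_⟩
  rw [← vertexMap_trans]
  refine hw _ _ fun t ht => ?_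
  rw [Function.Embedding.trans_apply, hτ t ht, dif_pos ht, (hg t ht).choose_spec]

theorem FinitelyGenerated.exists_surjective (hfg : G.FinitelyGenerated) :
    ∃ N : ℕ, ∀ m n : ℕ, N ≤ m → m ≤ n → ∀ v : G.V n,
      ∃ (w : G.V m) (f : Fin m ↪ Fin n), G.vertexMap f w = v := by
  obtain ⟨N, hN⟩ := eventually_atTop.1 hfg
  refine ⟨N, fun m n hm hmn => ?_⟩
  induction n, hmn using Nat.le_induction with
  | base => exact fun v => ⟨v, _, vertexMap_refl v⟩
  | succ n hmn ih =>
    intro v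
    obtain ⟨w, f, rfl⟩ := hN n (hm.trans hmn) v
    obtain ⟨w, g, rfl⟩ := ih w
    exact ⟨w, g.trans f, vertexMap_trans _ _ _⟩

/-- A vertex whose smallest support has `s` elements has at least `n.choose s` translates. -/
theorem choose_le_card_of_minimal_support {n : ℕ} {v : G.V n} {T : Finset (Fin n)}
    (hT : SupportedOn v T) (hmin : ∀ S, SupportedOn v S → T.card ≤ S.card)
    (hn : 3 * T.card ≤ n) : n.choose T.card ≤ Nat.card (G.V n) := by
  classical
  have hσ : ∀ S : {S : Finset (Fin n) // S.card = T.card},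
      ∃ σ : Fin n ↪ Fin n, T.map σ = S.1 := by
    rintro ⟨S, hS⟩
    let e := Finset.equivOfCardEq hS.symm
    obtain ⟨σ, hσ⟩ := Fin.exists_embedding_eqOn le_rfl T
      (fun t => if ht : t ∈ T then e ⟨t, ht⟩ else t) (by
        intro x hx y hy hxy
        simp only [Finset.mem_coe] at hx hy
        simp only [hx, hy, dif_pos] at hxy
        simpa using e.injective (Subtype.ext hxy))
    refine ⟨σ, Finset.eq_of_subset_of_card_le ?_ (by simp [hS])⟩
    intro x hx
    obtain ⟨t, ht, rfl⟩ := Finset.mem_map.1 hx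
    rw [hσ t ht, dif_pos ht]
    exact (e _).2
  choose σ hσ using hσ
  have hinj : Function.Injective
      fun S : {S : Finset (Fin n) // S.card = T.card} => G.vertexMap (σ S) v := by
    intro S S' hSS'
    have h1 : SupportedOn (G.vertexMap (σ S) v) S.1 := hσ S ▸ hT.vertexMap (σ S)
    have h2 : SupportedOn (G.vertexMap (σ S) v) S'.1 := by
      rw [show G.vertexMap (σ S) v = G.vertexMap (σ S') v from hSS']
      exact hσ S' ▸ hT.vertexMap (σ S')
    have h3 := h1.inter h2 (by rw [S.2, S'.2]; omega)
    -- Undoing `σ S` carries `S ∩ S'` to a support of `v`, so minimality forces `S = S'`.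
    obtain ⟨τ, hτ⟩ := Fin.exists_embedding_comp_eq le_rfl (σ S) (Function.Embedding.refl _)
    have h4 := h3.vertexMap τ
    rw [← vertexMap_trans, hτ, vertexMap_refl] at h4
    have h5 := hmin _ h4
    rw [Finset.card_map] at h5
    apply Subtype.ext
    have h6 := Finset.eq_of_subset_of_card_le (Finset.inter_subset_left (s₁ := S.1) (s₂ := S'.1))
      (by rw [S.2]; exact h5)
    have h7 := Finset.eq_of_subset_of_card_le (Finset.inter_subset_right (s₁ := S.1) (s₂ := S'.1))
      (by rw [S'.2]; exact h5)
    exact h6.symm.trans h7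
  have := Nat.card_le_card_of_injective _ hinj
  rwa [Nat.card_eq_fintype_card, Fintype.card_finset_len, Fintype.card_fin] at this

theorem exists_support_card_le_one (hfg : G.FinitelyGenerated) (hlin : G.VertexLinear) :
    ∃ N : ℕ, ∀ n, N ≤ n → ∀ v : G.V n, ∃ T : Finset (Fin n), T.card ≤ 1 ∧ SupportedOn v T := by
  obtain ⟨N, hN⟩ := hfg.exists_surjective
  obtain ⟨A, B, hAB⟩ := hlin
  obtain ⟨M, hM⟩ := eventually_atTop.1 hAB
  -- `3 * N` suffices because every vertex comes from `G_N`, so minimal supports have at most `N`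
  -- elements; the terms in `A`, `B` make `n.choose 2` exceed `A * n + B`.
  refine ⟨3 * N + M + 2 * A.natAbs + 2 * B.natAbs + 4, fun n hn v => ?_⟩
  obtain ⟨T, hT, hmin⟩ := exists_minimalFor_of_wellFoundedLT (SupportedOn v) Finset.card
    ⟨_, supportedOn_univ v⟩
  replace hmin : ∀ S, SupportedOn v S → T.card ≤ S.card := fun S hS =>
    (le_total T.card S.card).elim id (hmin hS)
  refine ⟨T, ?_, hT⟩
  by_contra! h2
  have hTN : T.card ≤ N := by
    obtain ⟨w, f, rfl⟩ := hN N n le_rfl (by omega) v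
    simpa using hmin _ ((supportedOn_univ w).vertexMap f)
  have h3 := choose_le_card_of_minimal_support hT hmin (by omega)
  have h4 : n.choose 2 ≤ n.choose T.card := by
    have : ∀ s, 2 ≤ s → s ≤ n / 2 → n.choose 2 ≤ n.choose s := by
      intro s hs
      induction s, hs using Nat.le_induction with
      | base => exact fun _ => le_rfl
      | succ s hs ih =>
        exact fun h => (ih (by omega)).trans (Nat.choose_le_succ_of_lt_half_left (by omega))
    exact this _ h2 (by omega)
  have h5 : ((n.choose 2 : ℕ) : ℚ) ≤ A * n + B := by
    have := hM n (by omega)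
    have h6 : ((n.choose 2 : ℕ) : ℤ) ≤ A * n + B := by rw [← this]; exact_mod_cast h4.trans h3
    exact_mod_cast h6
  rw [Nat.cast_choose_two] at h5
  have h7 : (2 * |(A : ℚ)| + 2 * |(B : ℚ)| + 4) ≤ n := by
    have : 2 * A.natAbs + 2 * B.natAbs + 4 ≤ n := by omega
    have h8 : ((2 * A.natAbs + 2 * B.natAbs + 4 : ℕ) : ℚ) ≤ n := by exact_mod_cast this
    simpa [Nat.cast_natAbs] using h8
  nlinarith [le_abs_self (A : ℚ), le_abs_self (B : ℚ), abs_nonneg (A : ℚ), abs_nonneg (B : ℚ),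
    mul_le_mul_of_nonneg_right (le_abs_self (A : ℚ)) (Nat.cast_nonneg (α := ℚ) n),
    mul_nonneg (abs_nonneg (B : ℚ)) (Nat.cast_nonneg (α := ℚ) n),
    mul_le_mul_of_nonneg_right h7 (Nat.cast_nonneg (α := ℚ) n)]

end FIGraph

/-! ### Convex sequences with bounded increments. -/

/-- A sequence of natural numbers that is eventually convex and has eventually bounded increments
is eventually linear. -/
theorem Nat.exists_eventually_linear_of_convex {a : ℕ → ℕ} {N C : ℕ}
    (hconv : ∀ n, N ≤ n → 2 * a (n + 1) ≤ a n + a (n + 2))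
    (hbdd : ∀ n, N ≤ n → a (n + 1) ≤ a n + C) :
    ∃ A B : ℤ, ∀ᶠ n : ℕ in atTop, (a n : ℤ) = A * (n : ℤ) + B := by
  -- `C` minus the increment is nonincreasing by convexity, and `hbdd` keeps the subtraction from
  -- truncating; well-foundedness of `ℕ` makes it eventually constant.
  let e : ℕ →o ℕᵒᵈ := ⟨fun n => OrderDual.toDual (C + a (N + n) - a (N + n + 1)),
    monotone_nat_of_le_succ fun n => by
      have h1 := hconv (N + n) (by omega)
      have h2 := hbdd (N + n) (by omega)
      have h3 := hbdd (N + n + 1) (by omega)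
      change C + a (N + (n + 1)) - a (N + (n + 1) + 1) ≤ C + a (N + n) - a (N + n + 1)
      simp only [← Nat.add_assoc] at h1 ⊢
      rw [show N + n + 1 + 1 = N + n + 2 from rfl] at h3 ⊢
      omega⟩
  obtain ⟨J, hJ⟩ := WellFoundedGT.monotone_chain_condition e
  let A : ℤ := a (N + J + 1) - a (N + J)
  refine ⟨A, a (N + J) - A * (N + J : ℕ), eventually_atTop.2 ⟨N + J, fun n hn => ?_⟩⟩
  induction n, hn using Nat.le_induction with
  | base => ring
  | succ n hn ih =>
    obtain ⟨k, rfl⟩ := Nat.exists_eq_add_of_le (show N ≤ n by omega)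
    have h1 : C + a (N + J) - a (N + J + 1) = C + a (N + k) - a (N + k + 1) := hJ k (by omega)
    have h2 := hbdd (N + J) (by omega)
    have h3 := hbdd (N + k) (by omega)
    have h4 : (a (N + k + 1) : ℤ) = a (N + k) + A := by simp only [A]; omega
    rw [h4, ih]
    push_cast
    ring

/-! ### Independence numbers of graphs on `P ⊕ Q × Fin n`. -/

section IndexedFamily

variable {P Q : Type*}

/-- The map on `P ⊕ Q × ι` induced by a map of index sets. -/
def reindex {ι κ : Type*} (f : ι → κ) : P ⊕ Q × ι → P ⊕ Q × κ := Sum.map id (Prod.map id f)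

@[simp] theorem reindex_inl {ι κ : Type*} (f : ι → κ) (p : P) :
    reindex f (Sum.inl p : P ⊕ Q × ι) = Sum.inl p := rfl

@[simp] theorem reindex_inr {ι κ : Type*} (f : ι → κ) (q : Q) (i : ι) :
    reindex f (Sum.inr (q, i) : P ⊕ Q × ι) = Sum.inr (q, f i) := rfl

theorem reindex_injective {ι κ : Type*} {f : ι → κ} (hf : Function.Injective f) :
    Function.Injective (reindex f : P ⊕ Q × ι → P ⊕ Q × κ) :=
  Sum.map_injective.2 ⟨Function.injective_id, Function.injective_id.prodMap hf⟩

variable {H : ∀ n : ℕ, SimpleGraph (P ⊕ Q × Fin n)} {N : ℕ}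

/-- Every injection of index sets induces an embedding of graphs, from level `N` on. -/
def EmbedsFrom (H : ∀ n : ℕ, SimpleGraph (P ⊕ Q × Fin n)) (N : ℕ) : Prop :=
  ∀ ⦃m n : ℕ⦄, N ≤ m → ∀ (f : Fin m ↪ Fin n) (x y : P ⊕ Q × Fin m),
    (H m).Adj x y ↔ (H n).Adj (reindex f x) (reindex f y)

/-- The part of `S` with index `i`. -/
noncomputable def slice {ι : Type*} (S : Finset (P ⊕ Q × ι)) (i : ι) : Finset Q :=
  S.preimage (fun q => Sum.inr (q, i)) fun q _ q' _ h => by simpa using h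

@[simp] theorem mem_slice {ι : Type*} {S : Finset (P ⊕ Q × ι)} {i : ι} {q : Q} :
    q ∈ slice S i ↔ Sum.inr (q, i) ∈ S :=
  Finset.mem_preimage

theorem card_slice_le [Finite Q] {ι : Type*} (S : Finset (P ⊕ Q × ι)) (i : ι) :
    (slice S i).card ≤ Nat.card Q := by
  have := Fintype.ofFinite Q
  rw [Nat.card_eq_fintype_card]
  exact Finset.card_le_univ _

/-- Removing the index `i` from an independent set. -/
theorem EmbedsFrom.card_le_indepNum_add_slice [Finite P] [Finite Q] (hH : EmbedsFrom H N) {n : ℕ}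
    (hn : N ≤ n) {S : Finset (P ⊕ Q × Fin (n + 1))} (hS : (H (n + 1)).IsIndepSet S)
    (i : Fin (n + 1)) : S.card ≤ (H n).indepNum + (slice S i).card := by
  classical
  let φ : P ⊕ Q × Fin n → P ⊕ Q × Fin (n + 1) := reindex (i.succAboveEmb)
  have hφ : Function.Injective φ := reindex_injective i.succAboveEmb.injective
  let S' : Finset (P ⊕ Q × Fin n) := S.preimage φ hφ.injOn
  have hS' : (H n).IsIndepSet S' := by
    intro x hx y hy hxy hadj
    exact hS (Finset.mem_preimage.1 hx) (Finset.mem_preimage.1 hy) (hφ.ne hxy)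
      ((hH hn _ x y).1 hadj)
  have hsub : S ⊆ S'.image φ ∪ (slice S i).image fun q => Sum.inr (q, i) := by
    intro x hx
    have key : ∀ y, φ y = x → x ∈ S'.image φ := fun y hy =>
      Finset.mem_image.2 ⟨y, Finset.mem_preimage.2 (hy ▸ hx), hy⟩
    rw [Finset.mem_union]
    rcases x with p | ⟨q, j⟩
    · exact Or.inl (key (Sum.inl p) rfl)
    · by_cases hij : j = i
      · subst hij
        exact Or.inr (Finset.mem_image.2 ⟨q, mem_slice.2 hx, rfl⟩)
      · obtain ⟨k, rfl⟩ := Fin.exists_succAbove_eq hij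
        exact Or.inl (key (Sum.inr (q, k)) rfl)
  calc S.card ≤ _ := Finset.card_le_card hsub
    _ ≤ _ := Finset.card_union_le _ _
    _ ≤ S'.card + (slice S i).card := Nat.add_le_add Finset.card_image_le Finset.card_image_le
    _ ≤ _ := Nat.add_le_add_right hS'.card_le_indepNum _

/-- Duplicating an index `i` of an independent set with the same slice as another index `j`. -/
theorem EmbedsFrom.card_add_slice_le_indepNum [Finite P] [Finite Q] (hH : EmbedsFrom H N) {n : ℕ}
    (hn : N ≤ n) {S : Finset (P ⊕ Q × Fin n)} (hS : (H n).IsIndepSet S) {i j : Fin n}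
    (hij : i ≠ j) (hslice : slice S i = slice S j) :
    S.card + (slice S i).card ≤ (H (n + 1)).indepNum := by
  classical
  let c : Fin n ↪ Fin (n + 1) := Fin.castSuccEmb
  have hc : ∀ k, c k ≠ Fin.last n := fun k => Fin.castSucc_ne_last k
  let up : Fin n → Fin n ↪ Fin (n + 1) := fun l =>
    ⟨fun k => if k = l then Fin.last n else c k, fun k k' h => by
      by_cases h1 : k = l <;> by_cases h2 : k' = l <;> simp only [h1, h2, if_true, if_false] at h
      · rw [h1, h2]
      · exact absurd h.symm (hc k')
      · exact absurd h (hc k)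
      · exact c.injective h⟩
  have up_self : ∀ l, up l l = Fin.last n := fun l => if_pos rfl
  have up_ne : ∀ l k, k ≠ l → up l k = c k := fun l k h => if_neg h
  let A : Finset (P ⊕ Q × Fin (n + 1)) := S.image (reindex c)
  let B : Finset (P ⊕ Q × Fin (n + 1)) := (slice S i).image fun q => Sum.inr (q, Fin.last n)
  have hAB : Disjoint A B := by
    rw [Finset.disjoint_left]
    intro x hx hx'
    obtain ⟨y, -, rfl⟩ := Finset.mem_image.1 hx
    obtain ⟨q, -, hq⟩ := Finset.mem_image.1 hx'
    rcases y with p | ⟨q', k⟩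
    · simp at hq
    · simp only [reindex_inr, Sum.inr.injEq, Prod.mk.injEq] at hq
      exact hc k hq.2.symm
  have hcard : (A ∪ B).card = S.card + (slice S i).card := by
    rw [Finset.card_union_of_disjoint hAB,
      Finset.card_image_of_injective _ (reindex_injective c.injective),
      Finset.card_image_of_injective _ fun q q' h => by simpa using h]
  have notAdj : ∀ (f : Fin n ↪ Fin (n + 1)) (x y), x ∈ S → y ∈ S →
      ¬ (H (n + 1)).Adj (reindex f x) (reindex f y) := by
    intro f x y hx hy hadj
    have h := (hH hn f x y).2 hadj
    exact hS hx hy h.ne h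
  have hAdjAB : ∀ x ∈ A, ∀ y ∈ B, ¬ (H (n + 1)).Adj x y := by
    intro x hx y hy
    obtain ⟨x, hxS, rfl⟩ := Finset.mem_image.1 hx
    obtain ⟨q, hq, rfl⟩ := Finset.mem_image.1 hy
    have hqi := mem_slice.1 hq
    -- Equal slices put `q` at `j` too: a vertex of index `i` is compared with this copy, moving `j`
    -- to the new index; all others are compared with the copy at `i`.
    have hqj := mem_slice.1 (hslice ▸ hq)
    rcases x with p | ⟨q', k⟩
    · simpa [up_self] using notAdj (up i) _ _ hxS hqi
    · by_cases hk : k = i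
      · subst hk
        simpa [up_self, up_ne _ _ hij] using notAdj (up j) _ _ hxS hqj
      · simpa [up_self, up_ne _ _ hk] using notAdj (up i) _ _ hxS hqi
  have hind : (H (n + 1)).IsIndepSet (A ∪ B : Finset _) := by
    intro x hx y hy _ hadj
    rcases Finset.mem_union.1 hx with hx | hx <;> rcases Finset.mem_union.1 hy with hy | hy
    · obtain ⟨x, hxS, rfl⟩ := Finset.mem_image.1 hx
      obtain ⟨y, hyS, rfl⟩ := Finset.mem_image.1 hy
      exact notAdj c x y hxS hyS hadj
    · exact hAdjAB x hx y hy hadj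
    · exact hAdjAB y hy x hx hadj.symm
    · obtain ⟨q, hq, rfl⟩ := Finset.mem_image.1 hx
      obtain ⟨q', hq', rfl⟩ := Finset.mem_image.1 hy
      refine notAdj (up i) _ _ (mem_slice.1 hq) (mem_slice.1 hq') ?_
      simpa [up_self] using hadj
  rw [← hcard]
  exact hind.card_le_indepNum

/-- If `s` is the size of a slice that a maximum independent set at level `n + 1` repeats, deletion
gives `α(n+1) ≤ α(n) + s` and duplication gives `α(n+1) + s ≤ α(n+2)`; adding these is convexity. -/
theorem EmbedsFrom.exists_indepNum_eventually_linear [Finite P] [Finite Q] (hH : EmbedsFrom H N) :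
    ∃ A B : ℤ, ∀ᶠ n : ℕ in atTop, ((H n).indepNum : ℤ) = A * (n : ℤ) + B := by
  classical
  have := Fintype.ofFinite Q
  refine Nat.exists_eventually_linear_of_convex (a := fun n => (H n).indepNum)
    (N := N + Fintype.card (Finset Q)) (C := Nat.card Q) (fun n hn => ?_) fun n hn => ?_
  · obtain ⟨S, hS⟩ := (H (n + 1)).exists_isNIndepSet_indepNum
    obtain ⟨i, j, hij, hslice⟩ := Fintype.exists_ne_map_eq_of_card_lt (slice S)
      (by rw [Fintype.card_fin]; omega)
    have h1 := hH.card_le_indepNum_add_slice (by omega) hS.isIndepSet i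
    have h2 := hH.card_add_slice_le_indepNum (by omega) hS.isIndepSet hij hslice
    rw [hS.card_eq] at h1 h2
    change 2 * (H (n + 1)).indepNum ≤ (H n).indepNum + (H (n + 1 + 1)).indepNum
    omega
  · obtain ⟨S, hS⟩ := (H (n + 1)).exists_isNIndepSet_indepNum
    have h1 := hH.card_le_indepNum_add_slice (by omega) hS.isIndepSet 0
    rw [hS.card_eq] at h1
    exact h1.trans (Nat.add_le_add_left (card_slice_le S 0) _)

end IndexedFamily

theorem SimpleGraph.Embedding.indepNum_le {V W : Type*} [Finite W] {G : SimpleGraph V}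
    {H : SimpleGraph W} (e : G ↪g H) : G.indepNum ≤ H.indepNum := by
  obtain ⟨S, hS⟩ := G.exists_isNIndepSet_indepNum
  have hmap : H.IsIndepSet (S.map e.toEmbedding : Finset W) := by
    intro x hx y hy hxy hadj
    obtain ⟨x, hxS, rfl⟩ := Finset.mem_map.1 hx
    obtain ⟨y, hyS, rfl⟩ := Finset.mem_map.1 hy
    have h : G.Adj x y := e.map_adj_iff.1 hadj
    exact hS.isIndepSet hxS hyS h.ne h
  simpa [hS.card_eq] using hmap.card_le_indepNum

theorem SimpleGraph.Iso.indepNum_eq {V W : Type*} [Finite V] [Finite W] {G : SimpleGraph V}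
    {H : SimpleGraph W} (e : G ≃g H) : G.indepNum = H.indepNum :=
  le_antisymm e.toEmbedding.indepNum_le e.symm.toEmbedding.indepNum_le

/-! ### The stable range. -/

namespace FIGraph

variable {G : FIGraph.{u}}

/-- Any two vertices of `G_m`, for `m ≥ N`, come from `G_N` through a common injection. -/
def PairGenerated (G : FIGraph.{u}) (N : ℕ) : Prop :=
  ∀ m, N ≤ m → ∀ u v : G.V m, ∃ (g : Fin N ↪ Fin m) (w w' : G.V N),
    G.vertexMap g w = u ∧ G.vertexMap g w' = v

/-- A family of relations preserved by all `G_f` is eventually also reflected by all `G_f`. -/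
theorem PairGenerated.exists_reflects {N : ℕ} (hN : PairGenerated G N)
    {R : ∀ n, G.V n → G.V n → Prop}
    (hR : ∀ {m n : ℕ} (f : Fin m ↪ Fin n) {u v : G.V m}, R m u v →
      R n (G.vertexMap f u) (G.vertexMap f v)) :
    ∃ N', N ≤ N' ∧ ∀ m n : ℕ, N' ≤ m → ∀ (f : Fin m ↪ Fin n) (u v : G.V m),
      R n (G.vertexMap f u) (G.vertexMap f v) → R m u v := by
  -- Two injections into `[n]` differ by a permutation of `[n]`.
  have indep : ∀ {n : ℕ} (f g : Fin N ↪ Fin n) (u v : G.V N),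
      R n (G.vertexMap f u) (G.vertexMap f v) → R n (G.vertexMap g u) (G.vertexMap g v) := by
    intro n f g u v h
    obtain ⟨σ, rfl⟩ := Fin.exists_embedding_comp_eq le_rfl f g
    simpa only [vertexMap_trans] using hR σ h
  let c : ∀ j, Fin N ↪ Fin (N + j) := fun j => Fin.castAddEmb j
  -- An increasing chain of subsets of a finite set, hence stationary.
  let K : ℕ →o Set (G.V N × G.V N) :=
    ⟨fun j => {p | R (N + j) (G.vertexMap (c j) p.1) (G.vertexMap (c j) p.2)},
      monotone_nat_of_le_succ fun j p hp => by
        refine indep ((c j).trans (Fin.castAddEmb 1)) _ _ _ ?_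
        simpa only [vertexMap_trans] using hR (Fin.castAddEmb 1) hp⟩
  obtain ⟨J, hJ⟩ := WellFoundedGT.monotone_chain_condition K
  refine ⟨N + J, Nat.le_add_right _ _, fun m n hm f u v huv => ?_⟩
  have hmn : m ≤ n := by simpa using Fintype.card_le_of_embedding f
  obtain ⟨a, rfl⟩ := Nat.exists_eq_add_of_le (show N ≤ m by omega)
  obtain ⟨b, rfl⟩ := Nat.exists_eq_add_of_le (show N ≤ n by omega)
  obtain ⟨g, w, w', rfl, rfl⟩ := hN _ (Nat.le_add_right _ _) u v
  rw [← vertexMap_trans, ← vertexMap_trans] at huv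
  have h1 : (w, w') ∈ K b := indep _ _ _ _ huv
  rw [← hJ b (by omega), hJ a (by omega)] at h1
  exact indep _ _ _ _ h1

/-- Two supports have at most two elements in total, so a single injection from `n ≥ 2` points
covers the images of both. -/
theorem exists_pairGenerated (hfg : G.FinitelyGenerated) (hlin : G.VertexLinear) :
    ∃ N, ∀ n, N ≤ n → PairGenerated G n ∧
      ∀ v : G.V n, ∃ T : Finset (Fin n), T.card ≤ 1 ∧ SupportedOn v T := by
  classical
  obtain ⟨N₁, h₁⟩ := hfg.exists_surjective
  obtain ⟨N₂, h₂⟩ := exists_support_card_le_one hfg hlin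
  refine ⟨N₁ + N₂ + 2, fun n hn => ⟨fun m hm u v => ?_, h₂ n (by omega)⟩⟩
  obtain ⟨w, f, rfl⟩ := h₁ n m (by omega) hm u
  obtain ⟨w', f', rfl⟩ := h₁ n m (by omega) hm v
  obtain ⟨T, hT, hw⟩ := h₂ n (by omega) w
  obtain ⟨T', hT', hw'⟩ := h₂ n (by omega) w'
  obtain ⟨g, hg⟩ := Fin.exists_embedding_subset_range hm (T.map f ∪ T'.map f')
    ((Finset.card_union_le _ _).trans (by simp only [Finset.card_map]; omega))
  obtain ⟨x, hx⟩ := hw.exists_vertexMap_eq le_rfl f g fun t ht =>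
    hg _ (Finset.mem_union_left _ (Finset.mem_map_of_mem f ht))
  obtain ⟨x', hx'⟩ := hw'.exists_vertexMap_eq le_rfl f' g fun t ht =>
    hg _ (Finset.mem_union_right _ (Finset.mem_map_of_mem f' ht))
  exact ⟨g, x, x', hx, hx'⟩

/-- From some level on, all `G_f` are embeddings of graphs, all vertices come from the first level
and have supports with at most one element. -/
theorem exists_stable_range (hfg : G.FinitelyGenerated) (hlin : G.VertexLinear) :
    ∃ N, 3 ≤ N ∧ (∀ n, N ≤ n → ∀ (f : Fin N ↪ Fin n), Function.Injective (G.vertexMap f)) ∧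
      (∀ m n : ℕ, N ≤ m → ∀ (f : Fin m ↪ Fin n) (u v : G.V m),
        (G.graph n).Adj (G.vertexMap f u) (G.vertexMap f v) ↔ (G.graph m).Adj u v) ∧
      (∀ n, N ≤ n → ∀ v : G.V n, ∃ (w : G.V N) (f : Fin N ↪ Fin n), G.vertexMap f w = v) ∧
      ∀ v : G.V N, ∃ T : Finset (Fin N), T.card ≤ 1 ∧ SupportedOn v T := by
  obtain ⟨N₁, h₁⟩ := exists_pairGenerated hfg hlin
  obtain ⟨N₂, hN₂, h₂⟩ := (h₁ N₁ le_rfl).1.exists_reflects (R := fun n u v => u = v)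
    (fun f u v h => by rw [h])
  obtain ⟨N₃, hN₃, h₃⟩ := (h₁ N₁ le_rfl).1.exists_reflects (R := fun n => (G.graph n).Adj)
    (fun f u v h => adj_vertexMap f h)
  obtain ⟨h₄, h₅⟩ := h₁ (N₂ + N₃ + 3) (by omega)
  refine ⟨N₂ + N₃ + 3, by omega, fun n hn f u v h => h₂ _ n (by omega) f u v h,
    fun m n hm f u v => ⟨h₃ m n (by omega) f u v, adj_vertexMap f⟩, fun n hn v => ?_, h₅⟩
  obtain ⟨g, w, -, hw, -⟩ := h₄ n hn v v
  exact ⟨w, g, hw⟩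

end FIGraph

theorem theorem1p2 (G : FIGraph.{u}) (hfg : G.FinitelyGenerated) (hlin : G.VertexLinear) :
    ∃ A B : ℤ, ∀ᶠ n : ℕ in Filter.atTop,
      ((G.graph n).indepNum : ℤ) = A * (n : ℤ) + B := by
  classical
  obtain ⟨N, hN3, hinj, hadj, hgen, hsupp⟩ := FIGraph.exists_stable_range hfg hlin
  let o : Fin N := ⟨0, by omega⟩
  -- `P` collects the vertices fixed by all permutations, `Q` those depending exactly on the base
  -- point `o`; the index in `Q × Fin n` is the image of `o`.
  let P := {v : G.V N // FIGraph.SupportedOn v ∅}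
  let Q := {v : G.V N // FIGraph.SupportedOn v {o} ∧ ¬ FIGraph.SupportedOn v ∅}
  have hframe : ∀ n, N ≤ n → ∀ i : Fin n, ∃ f : Fin N ↪ Fin n, f o = i := by
    intro n hn i
    obtain ⟨f, hf⟩ := Fin.exists_embedding_eqOn hn {o} (fun _ => i) (by simp)
    exact ⟨f, hf o (by simp)⟩
  choose F hF using hframe
  let E : ∀ n, N ≤ n → P ⊕ Q × Fin n → G.V n := fun n hn =>
    Sum.elim (fun p => G.vertexMap (Fin.castLEEmb hn) p.1)
      (fun qi => G.vertexMap (F n hn qi.2) qi.1.1)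
  have hEl : ∀ n (hn : N ≤ n) (f : Fin N ↪ Fin n) (p : P),
      E n hn (Sum.inl p) = G.vertexMap f p.1 := fun n hn f p => p.2 _ _ (by simp)
  have hEr : ∀ n (hn : N ≤ n) (f : Fin N ↪ Fin n) (q : Q) (i : Fin n), f o = i →
      E n hn (Sum.inr (q, i)) = G.vertexMap f q.1 := fun n hn f q i hf =>
    q.2.1 _ _ (by simp [hF, hf])
  have hEnat : ∀ m n (hm : N ≤ m) (hn : N ≤ n) (f : Fin m ↪ Fin n) (x : P ⊕ Q × Fin m),
      E n hn (reindex f x) = G.vertexMap f (E m hm x) := by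
    rintro m n hm hn f (p | ⟨q, i⟩)
    · rw [reindex_inl, hEl m hm (Fin.castLEEmb hm), ← FIGraph.vertexMap_trans, ← hEl n hn]
    · rw [reindex_inr, hEr m hm (F m hm i) q i (hF m hm i), ← FIGraph.vertexMap_trans]
      exact hEr n hn _ q _ (by simp [hF])
  have hEbij : ∀ n (hn : N ≤ n), Function.Bijective (E n hn) := by
    intro n hn
    constructor
    · have hlr : ∀ (p : P) (q : Q) (i : Fin n), E n hn (Sum.inl p) ≠ E n hn (Sum.inr (q, i)) := by
        intro p q i h
        rw [hEl n hn (F n hn i), hEr n hn (F n hn i) q i (hF n hn i)] at h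
        exact q.2.2 (hinj n hn _ h ▸ p.2)
      rintro (p | ⟨q, i⟩) (p' | ⟨q', i'⟩) h
      · rw [hEl n hn (Fin.castLEEmb hn), hEl n hn (Fin.castLEEmb hn)] at h
        rw [Subtype.ext (hinj n hn _ h)]
      · exact absurd h (hlr _ _ _)
      · exact absurd h.symm (hlr _ _ _)
      · by_cases hi : i = i'
        · subst hi
          rw [hEr n hn (F n hn i) q i (hF n hn i), hEr n hn (F n hn i) q' i (hF n hn i)] at h
          rw [Subtype.ext (hinj n hn _ h)]
        · exfalso
          -- With `o ↦ i` and `a ↦ i'` under one `f`, injectivity of `G_f` makes `q` supported on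
          -- both `{o}` and `{a}`, hence on `∅`; `3 ≤ N` is the room `SupportedOn.inter` needs.
          let a : Fin N := ⟨1, by omega⟩
          have hoa : o ≠ a := by simp [o, a]
          obtain ⟨f, hf⟩ := Fin.exists_embedding_eqOn hn {o, a} (fun x => if x = o then i else i')
            (by
              intro x hx y hy hxy
              simp only [Finset.coe_insert, Finset.coe_singleton, Set.mem_insert_iff,
                Set.mem_singleton_iff] at hx hy
              rcases hx with hx | hx <;> rcases hy with hy | hy <;>
                simp only [hx, hy, if_pos, if_neg hoa.symm] at hxy ⊢
              · exact absurd hxy hi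
              · exact absurd hxy.symm hi)
          have hfo : f o = i := by rw [hf o (by simp), if_pos rfl]
          have hfa : f a = i' := by rw [hf a (by simp), if_neg hoa.symm]
          let s : Fin N ↪ Fin N := (Equiv.swap o a).toEmbedding
          have hso : s o = a := Equiv.swap_apply_left o a
          rw [hEr n hn f q i hfo, hEr n hn (s.trans f) q' i' (by simp [hso, hfa]),
            FIGraph.vertexMap_trans] at h
          have h1 : FIGraph.SupportedOn q.1 {a} := by
            rw [hinj n hn _ h]
            simpa [hso] using q'.2.1.vertexMap s
          have h2 := q.2.1.inter h1 (by simpa using hN3)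
          rw [Finset.singleton_inter_of_notMem (by simpa using hoa)] at h2
          exact q.2.2 h2
    · intro v
      obtain ⟨w, f, rfl⟩ := hgen n hn v
      by_cases hw : FIGraph.SupportedOn w ∅
      · exact ⟨Sum.inl ⟨w, hw⟩, hEl n hn f _⟩
      obtain ⟨T, hT, hwT⟩ := hsupp w
      obtain ⟨j, hj⟩ : ∃ j, T ⊆ {j} := by
        have : T.Nonempty := Finset.nonempty_iff_ne_empty.2 (by rintro rfl; exact hw hwT)
        obtain ⟨j, hj⟩ := Finset.card_eq_one.1 (le_antisymm hT this.card_pos)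
        exact ⟨j, hj.subset⟩
      let s : Fin N ↪ Fin N := (Equiv.swap o j).toEmbedding
      have hss : s.trans s = Function.Embedding.refl _ :=
        Function.Embedding.ext fun x => by simp [s]
      have hsw : G.vertexMap s (G.vertexMap s w) = w := by
        rw [← FIGraph.vertexMap_trans, hss, FIGraph.vertexMap_refl]
      have hso : s o = j := Equiv.swap_apply_left o j
      have hsj : s j = o := Equiv.swap_apply_right o j
      refine ⟨Sum.inr (⟨G.vertexMap s w, ?_, fun h => hw ?_⟩, f j), ?_⟩
      · simpa [hsj] using (hwT.mono hj).vertexMap s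
      · simpa [hsw] using h.vertexMap s
      · rw [hEr n hn (s.trans f) _ _ (by simp [hso]), FIGraph.vertexMap_trans, hsw]
  let H : ∀ n, SimpleGraph (P ⊕ Q × Fin n) := fun n =>
    -- The value below `N` is arbitrary, since `EmbedsFrom H N` starts at level `N`.
    if hn : N ≤ n then (G.graph n).comap (E n hn) else ⊥
  have hHE : ∀ n (hn : N ≤ n), H n = (G.graph n).comap (E n hn) := fun n hn => dif_pos hn
  have hH : EmbedsFrom H N := by
    intro m n hm f x y
    have hn : N ≤ n := hm.trans (by simpa using Fintype.card_le_of_embedding f)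
    rw [hHE m hm, hHE n hn, SimpleGraph.comap_adj, SimpleGraph.comap_adj, hEnat m n hm hn,
      hEnat m n hm hn, hadj m n hm f]
  obtain ⟨A, B, hAB⟩ := hH.exists_indepNum_eventually_linear
  refine ⟨A, B, ?_⟩
  filter_upwards [hAB, eventually_ge_atTop N] with n hn hNn
  rw [← hn, hHE n hNn]
  exact_mod_cast (SimpleGraph.Iso.indepNum_eq
    (⟨Equiv.ofBijective _ (hEbij n hNn), Iff.rfl⟩ :
      (G.graph n).comap (E n hNn) ≃g G.graph n)).symm
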